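/- A multiring is a tuple $(A,+,-,\cdot,0,1)$ in which $(A,\cdot,1)$ is a commutative monoid, $+$ assigns to each pair of elements a nonempty subset of $A$, $-\colon A\to A$ is a map, and for all $a,b,c,d,g,x\in A$: $a\in b+c$ implies $c\in -b+a$ and $b\in a+(-c)$; $a\in b+0$ iff $a=b$; if $x\in g+c$ with $g\in a+b$, then $x\in a+h$ for some $h\in b+c$; $a+b=b+a$; $a\cdot 0=0$; and $a\in b+c$ implies $ad\in bd+cd$. It is a hyperring if moreover each $x\in bd+cd$ is of the form $x=ad$ with $a\in b+c$. Write $a-b$ for $a+(-b)$; iterated sums are formed elementwise. A multiring $A$ is a real reduced multiring if $-1$ lies in no finite sum of squares $a_1^2+\cdots+a_n^2$ and, for all $a,b\in A$, $a^3=a$, $a+b^2a=\{a\}$, and $a^2+b^2$ has exactly one element. A real reduced hyperring is a real reduced multiring that is a hyperring. A von Neumann hyperring is a hyperring in which each $a$ satisfies $a=a^2b$ for some $b$. An ideal of $A$ is a subset containing $0$ that is closed under sums ($x,y\in\alpha$ implies $x+y\subseteq\alpha$) and under multiplication by elements of $A$; it is prime if it does not contain $1$ and $ab\in p$ implies $a\in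 p$ or $b\in p$. Let $\operatorname{spec}(A)$ be the set of prime ideals, $D(a)=\{p\in\operatorname{spec}(A): a\notin p\}$, and let $S_a$ be the multiplicative set of those $x\in A$ such that some $a^n$ ($n\ge 0$, with $a^0=1$) lies in the smallest ideal containing $x$. For a multiplicative set $S$, the multiring $S^{-1}A$ consists of fractions $a/s$ with $a/s=b/t$ iff $atu=bsu$ for some $u\in S$, the obvious product, zero, one and negation, and $a/s\in b/t+c/u$ iff $atuv\in bsuv+cstv$ for some $v\in S$. Put $\mathcal F(D(a))=S_a^{-1}A$; if $D(b)\subseteq D(a)$ then $S_a\subseteq S_b$, and the restriction map $\mathcal F(D(a))\to\mathcal F(D(b))$ is $x/s\mapsto x/s$. The multiring $A$ is geometric if $\mathcal F$ is a sheaf, i.e. for every cover $D(e)=\bigcup_{i\in I}D(e_i)$: * if $a,b,c\in\mathcal F(D(e))$ and $a|_{D(e_i)}\in b|_{D(e_i)}+c|_{D(e_i)}$ for every $i\in I$, then $a\in b+c$; * if $x_i\in\mathcal F(D(e_i))$ $(i\in I)$ and $x_i|_{D(e_ie_j)}=x_j|_{D(e_ie_j)}$ for all $i,j\in I$, then there is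 $x\in\mathcal F(D(e))$ with $x|_{D(e_i)}=x_i$ for every $i\in I$. **Proposition.** Let $A$ be a multiring with $1\ne 0$. The following are equivalent: 1. $A$ is a real reduced multiring and for each $a\in A$ there is $x\in A$ with $ax=0$ and $x\in 1-a^2$; 2. $A$ is a real reduced hyperring; 3. $A$ is a geometric von Neumann hyperring and $1+a^2=\{1\}$ for all $a\in A$. -/

import Mathlib

universe u

/-- A multiring: a commutative monoid with a nonempty-set-valued sum `madd`, a negation and a zero.
The multiplicative unit is that of the underlying commutative monoid. -/
class Multiring (A : Type u) extends CommMonoid A, Zero A, Neg A where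
  madd : A → A → Set A
  madd_nonempty : ∀ a b : A, (madd a b).Nonempty
  mem_madd_left : ∀ {a b c : A}, a ∈ madd b c → c ∈ madd (-b) a
  mem_madd_right : ∀ {a b c : A}, a ∈ madd b c → b ∈ madd a (-c)
  mem_madd_zero : ∀ {a b : A}, a ∈ madd b 0 ↔ a = b
  madd_assoc : ∀ {a b c g x : A}, x ∈ madd g c → g ∈ madd a b → ∃ h ∈ madd b c, x ∈ madd a h
  madd_comm : ∀ a b : A, madd a b = madd b a
  mul_zero' : ∀ a : A, a * 0 = 0
  mul_mem_madd : ∀ {a b c : A}, a ∈ madd b c → ∀ d : A, a * d ∈ madd (b * d) (c * d)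

namespace Multiring

section Basic

variable (A : Type u) [Multiring A]

/-- A hyperring is a multiring in which half distributivity admits a converse. -/
def IsHyperring : Prop :=
  ∀ b c d x : A, x ∈ madd (b * d) (c * d) → ∃ a ∈ madd b c, x = a * d

variable {A}

/-- Iterated sums: `msum [x₁, …, xₙ] = {x₁} + (x₂ + ⋯ + xₙ)`, and the empty sum is `{0}`. -/
def msum : List A → Set A
  | [] => {0}
  | x :: l => {y | ∃ z ∈ msum l, y ∈ madd x z}

variable (A)

/-- The set of all elements lying in some finite sum of squares `a₁² + ⋯ + aₙ²`. (The empty sum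
adds nothing, since `0 = 0²`.) -/
def sumSquares : Set A :=
  {y | ∃ l : List A, y ∈ msum (l.map fun a => a ^ 2)}

/-- `-1` is not a sum of squares. -/
def IsSemiReal : Prop := (-1 : A) ∉ sumSquares A

/-- Real reduced multirings. -/
structure IsRealReduced : Prop where
  semiReal : IsSemiReal A
  cube : ∀ a : A, a ^ 3 = a
  add_sq_mul : ∀ a b : A, madd a (b ^ 2 * a) = {a}
  sq_add_sq : ∀ a b : A, ∃ c : A, madd (a ^ 2) (b ^ 2) = {c}

/-- Von Neumann (regular) hyperrings. -/
structure IsVonNeumannHyperring : Prop where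
  hyper : IsHyperring A
  regular : ∀ a : A, ∃ b : A, a = a ^ 2 * b

variable {A}

/-- Ideals of a multiring. -/
structure IsIdeal (α : Set A) : Prop where
  zero_mem : (0 : A) ∈ α
  add_subset : ∀ ⦃a⦄, a ∈ α → ∀ ⦃b⦄, b ∈ α → madd a b ⊆ α
  mul_mem : ∀ (r : A) ⦃a⦄, a ∈ α → r * a ∈ α

structure IsPrimeIdeal (p : Set A) : Prop extends IsIdeal p where
  one_notMem : (1 : A) ∉ p
  mem_or_mem : ∀ ⦃a b : A⦄, a * b ∈ p → a ∈ p ∨ b ∈ p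

variable (A)

/-- The prime spectrum. -/
def Spec : Type u := {p : Set A // IsPrimeIdeal p}

variable {A}

/-- The basic open set `D(a)`: the primes not containing `a`. -/
def D (a : A) : Set (Spec A) := {p | a ∉ p.1}

/-- The principal ideal `(x)`, i.e. the smallest ideal containing `x`. -/
def genBy (x : A) : Set A := ⋂₀ {α | IsIdeal α ∧ x ∈ α}

theorem mem_congr {a b c a' b' c' : A} (h : a ∈ madd b c) (ha : a' = a) (hb : b' = b)
    (hc : c' = c) : a' ∈ madd b' c' := by
  subst ha hb hc
  exact h

theorem zero_mul' (a : A) : 0 * a = 0 := by rw [mul_comm, mul_zero']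

theorem IsIdeal.colon {α : Set A} (h : IsIdeal α) (y : A) : IsIdeal {z | z * y ∈ α} where
  zero_mem := by simpa [zero_mul'] using h.zero_mem
  add_subset := fun a ha b hb c hc => h.add_subset ha hb (mul_mem_madd hc y)
  mul_mem := fun r a ha => by
    have := h.mul_mem r ha
    simpa [mul_assoc] using this

theorem genBy_isIdeal (x : A) : IsIdeal (genBy x) where
  zero_mem := fun _ hα => hα.1.zero_mem
  add_subset := fun _ ha _ hb _ hc α hα => hα.1.add_subset (ha α hα) (hb α hα) hc
  mul_mem := fun r _ ha α hα => hα.1.mul_mem r (ha α hα)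

theorem mem_genBy (x : A) : x ∈ genBy x := fun _ hα => hα.2

theorem mul_mem_genBy {w z x y : A} (hw : w ∈ genBy x) (hz : z ∈ genBy y) :
    w * z ∈ genBy (x * y) := by
  intro α hα
  have h1 : w * y ∈ α := hw _ ⟨hα.1.colon y, hα.2⟩
  have h2 : z * w ∈ α := hz _ ⟨hα.1.colon w, by simpa [mul_comm] using h1⟩
  simpa [mul_comm] using h2

/-- The multiplicative set `S_a` of all `x` such that some power of `a` lies in `(x)`. -/
def S (a : A) : Submonoid A where
  carrier := {x | ∃ n : ℕ, a ^ n ∈ genBy x}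
  one_mem' := ⟨0, by simpa using mem_genBy (1 : A)⟩
  mul_mem' := by
    rintro x y ⟨m, hm⟩ ⟨n, hn⟩
    exact ⟨m + n, by simpa [pow_add] using mul_mem_genBy hm hn⟩

/-- Prime ideal theorem: an ideal that misses all powers of `a` is contained in a prime ideal that
does not contain `a`. -/
theorem exists_prime {I : Set A} (hI : IsIdeal I) (a : A) (ha : ∀ n : ℕ, a ^ n ∉ I) :
    ∃ p : Set A, IsPrimeIdeal p ∧ I ⊆ p ∧ a ∉ p := by
  obtain ⟨p, hIp, hp⟩ := zorn_subset_nonempty {J : Set A | IsIdeal J ∧ ∀ n : ℕ, a ^ n ∉ J} (by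
    intro c hc hchain hne
    refine ⟨⋃₀ c, ⟨⟨?_, ?_, ?_⟩, ?_⟩, fun s hs => Set.subset_sUnion_of_mem hs⟩
    · obtain ⟨s, hs⟩ := hne
      exact ⟨s, hs, (hc hs).1.zero_mem⟩
    · rintro x ⟨s, hs, hx⟩ y ⟨t, ht, hy⟩ z hz
      rcases hchain.total hs ht with h | h
      · exact ⟨t, ht, (hc ht).1.add_subset (h hx) hy hz⟩
      · exact ⟨s, hs, (hc hs).1.add_subset hx (h hy) hz⟩
    · rintro r x ⟨s, hs, hx⟩
      exact ⟨s, hs, (hc hs).1.mul_mem r hx⟩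
    · rintro n ⟨s, hs, hx⟩
      exact (hc hs).2 n hx) I ⟨hI, ha⟩
  have key : ∀ u : A, u ∉ p →
      ∃ n : ℕ, a ^ n ∈ ⋂₀ {α : Set A | IsIdeal α ∧ p ⊆ α ∧ u ∈ α} := by
    intro u hu
    by_contra hcon
    push Not at hcon
    have hle := hp.2 (y := ⋂₀ {α : Set A | IsIdeal α ∧ p ⊆ α ∧ u ∈ α})
      ⟨⟨fun _ hα => hα.1.zero_mem,
        fun _ hx _ hy _ hz α hα => hα.1.add_subset (hx α hα) (hy α hα) hz,
        fun r _ hx α hα => hα.1.mul_mem r (hx α hα)⟩, hcon⟩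
      (fun x hx α hα => hα.2.1 hx)
    exact hu (hle fun _ hα => hα.2.2)
  have hpi : IsIdeal p := hp.1.1
  refine ⟨p, ⟨hpi, fun h => hp.1.2 0 (by simpa using h), ?_⟩, hIp,
    fun h => hp.1.2 1 (by simpa using h)⟩
  intro u v huv
  by_contra hcon
  push Not at hcon
  obtain ⟨m, hm⟩ := key u hcon.1
  obtain ⟨n, hn⟩ := key v hcon.2
  have h1 : a ^ m * v ∈ p :=
    hm _ ⟨hpi.colon v, fun x hx => by simpa [mul_comm] using hpi.mul_mem v hx, huv⟩
  have h2 : a ^ n * a ^ m ∈ p :=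
    hn _ ⟨hpi.colon (a ^ m), fun x hx => by simpa [mul_comm] using hpi.mul_mem (a ^ m) hx,
      by simpa [mul_comm] using h1⟩
  exact hp.1.2 (n + m) (by simpa [pow_add] using h2)

theorem S_le_of_D_subset {a b : A} (h : D a ⊆ D b) : S b ≤ S a := by
  rintro x ⟨n, hn⟩
  by_contra hx
  obtain ⟨p, hp, hxp, hap⟩ := exists_prime (genBy_isIdeal x) a (fun k hk => hx ⟨k, hk⟩)
  have hbp : b ∉ p := h (a := (⟨p, hp⟩ : Spec A)) hap
  have : ∀ k : ℕ, b ^ k ∉ p := by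
    intro k
    induction k with
    | zero => simpa using hp.one_notMem
    | succ k ih =>
      rw [pow_succ]
      intro hk
      rcases hp.mem_or_mem hk with h' | h'
      · exact ih h'
      · exact hbp h'
  exact this n (hxp hn)

theorem D_mul_subset_left (a b : A) : D (a * b) ⊆ D a := by
  intro p hp ha
  exact hp (by simpa [mul_comm] using p.2.mul_mem b ha)

theorem D_mul_subset_right (a b : A) : D (a * b) ⊆ D b :=
  fun p hp hb => hp (p.2.mul_mem a hb)

end Basic

section Localization

variable {A : Type u} [Multiring A] (T : Submonoid A)

/-- The sum of `S⁻¹A`: `a/s ∈ b/t + c/w` iff `a t w v ∈ b s w v + c s t v` for some `v ∈ S`. -/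
def locAdd (y z : Localization T) : Set (Localization T) :=
  {x | ∃ (a b c : A) (s t w v : T), x = Localization.mk a s ∧ y = Localization.mk b t ∧
    z = Localization.mk c w ∧ a * (t * w * v) ∈ madd (b * (s * w * v)) (c * (s * t * v))}

variable {T}

theorem mk_mem_locAdd {a b c : A} {s t w : T} :
    Localization.mk a s ∈ locAdd T (Localization.mk b t) (Localization.mk c w) ↔
      ∃ v : T, a * (t * w * v) ∈ madd (b * (s * w * v)) (c * (s * t * v)) := by
  constructor
  · rintro ⟨a', b', c', s', t', w', v, ha, hb, hc, h⟩
    rw [Localization.mk_eq_mk_iff, Localization.r_iff_exists] at ha hb hc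
    obtain ⟨k, hk⟩ := ha
    obtain ⟨l, hl⟩ := hb
    obtain ⟨m, hm⟩ := hc
    refine ⟨s' * t' * w' * v * k * l * m, ?_⟩
    have := mul_mem_madd h (s * t * w * k * l * m : A)
    push_cast
    refine mem_congr this ?_ ?_ ?_
    · calc a * (t * w * (s' * t' * w' * v * k * l * m) : A)
          = (k * (s' * a)) * (t * w * t' * w' * v * l * m) := by ac_rfl
        _ = (k * (s * a')) * (t * w * t' * w' * v * l * m) := by rw [hk]
        _ = _ := by ac_rfl
    · calc b * (s * w * (s' * t' * w' * v * k * l * m) : A)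
          = (l * (t' * b)) * (s * w * s' * w' * v * k * m) := by ac_rfl
        _ = (l * (t * b')) * (s * w * s' * w' * v * k * m) := by rw [hl]
        _ = _ := by ac_rfl
    · calc c * (s * t * (s' * t' * w' * v * k * l * m) : A)
          = (m * (w' * c)) * (s * t * s' * t' * v * k * l) := by ac_rfl
        _ = (m * (w * c')) * (s * t * s' * t' * v * k * l) := by rw [hm]
        _ = _ := by ac_rfl
  · rintro ⟨v, h⟩
    exact ⟨a, b, c, s, t, w, v, rfl, rfl, rfl, h⟩

theorem mk_mem_locAdd_common {a b c : A} {s : T} :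
    Localization.mk a s ∈ locAdd T (Localization.mk b s) (Localization.mk c s) ↔
      ∃ v : T, a * v ∈ madd (b * v) (c * v) := by
  rw [mk_mem_locAdd]
  constructor
  · rintro ⟨v, h⟩
    exact ⟨s * s * v, by simpa using h⟩
  · rintro ⟨v, h⟩
    refine ⟨v, ?_⟩
    exact mem_congr (mul_mem_madd h (s * s : A)) (by ac_rfl) (by ac_rfl) (by ac_rfl)

theorem mk_mul_den (a : A) (s t : T) :
    Localization.mk a s = Localization.mk (a * t) (s * t) := by
  rw [Localization.mk_eq_mk_iff, Localization.r_iff_exists]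
  exact ⟨1, by push_cast; ac_rfl⟩

theorem exists_common₂ (x y : Localization T) :
    ∃ (a b : A) (s : T), x = Localization.mk a s ∧ y = Localization.mk b s := by
  induction x using Localization.induction_on with | H p => ?_
  induction y using Localization.induction_on with | H q => ?_
  refine ⟨p.1 * q.2, q.1 * p.2, p.2 * q.2, mk_mul_den _ _ _, ?_⟩
  rw [mul_comm p.2 q.2]
  exact mk_mul_den _ _ _

theorem exists_common₃ (x y z : Localization T) :
    ∃ (a b c : A) (s : T), x = Localization.mk a s ∧ y = Localization.mk b s ∧
      z = Localization.mk c s := by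
  obtain ⟨a, b, s, rfl, rfl⟩ := exists_common₂ x y
  induction z using Localization.induction_on with | H p => ?_
  refine ⟨a * p.2, b * p.2, p.1 * s, s * p.2, mk_mul_den _ _ _, mk_mul_den _ _ _, ?_⟩
  rw [mul_comm s p.2]
  exact mk_mul_den _ _ _

theorem neg_mul' (a b : A) : -a * b = -(a * b) := by
  have h0 : (0 : A) ∈ madd (-a) a := mem_madd_left (mem_madd_zero.2 rfl)
  have h1 : (0 : A) ∈ madd (a * b) (-a * b) := by
    rw [madd_comm]
    simpa [zero_mul'] using mul_mem_madd h0 b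
  exact mem_madd_zero.1 (mem_madd_left h1)

instance : Zero (Localization T) := ⟨Localization.mk 0 1⟩

/-- `-(a/s) = (-a)/s`. -/
instance : Neg (Localization T) :=
  ⟨fun x => x.liftOn (fun a s => Localization.mk (-a) s) (by
    intro a c b d h
    rw [Localization.r_iff_exists] at h
    obtain ⟨k, hk⟩ := h
    rw [Localization.mk_eq_mk_iff, Localization.r_iff_exists]
    refine ⟨k, ?_⟩
    have := congrArg (fun x : A => -x) hk
    simp only at this
    rw [mul_comm (d : A) (-a), mul_comm (b : A) (-c), mul_comm (k : A), mul_comm (k : A),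
      neg_mul', neg_mul', neg_mul', neg_mul']
    rw [mul_comm (k : A), mul_comm (k : A), mul_comm (d : A), mul_comm (b : A)] at this
    exact this)⟩

theorem neg_mk (a : A) (s : T) : -(Localization.mk a s) = Localization.mk (-a) s := rfl

theorem zero_eq_mk (s : T) : (0 : Localization T) = Localization.mk 0 s := by
  change Localization.mk 0 1 = _
  rw [mk_mul_den 0 1 s, zero_mul', one_mul]

instance : Multiring (Localization T) where
  madd := locAdd T
  madd_nonempty y z := by
    obtain ⟨b, c, s, rfl, rfl⟩ := exists_common₂ y z
    obtain ⟨a, ha⟩ := madd_nonempty b c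
    exact ⟨Localization.mk a s, mk_mem_locAdd_common.2 ⟨1, by simpa using ha⟩⟩
  mem_madd_left := by
    intro x y z h
    obtain ⟨a, b, c, s, rfl, rfl, rfl⟩ := exists_common₃ x y z
    obtain ⟨v, hv⟩ := mk_mem_locAdd_common.1 h
    rw [neg_mk]
    exact mk_mem_locAdd_common.2 ⟨v, by rw [neg_mul']; exact mem_madd_left hv⟩
  mem_madd_right := by
    intro x y z h
    obtain ⟨a, b, c, s, rfl, rfl, rfl⟩ := exists_common₃ x y z
    obtain ⟨v, hv⟩ := mk_mem_locAdd_common.1 h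
    rw [neg_mk]
    exact mk_mem_locAdd_common.2 ⟨v, by rw [neg_mul']; exact mem_madd_right hv⟩
  mem_madd_zero := by
    intro x y
    obtain ⟨a, b, s, rfl, rfl⟩ := exists_common₂ x y
    rw [zero_eq_mk s, mk_mem_locAdd_common, Localization.mk_eq_mk_iff, Localization.r_iff_exists]
    constructor
    · rintro ⟨v, hv⟩
      rw [zero_mul', mem_madd_zero] at hv
      refine ⟨v, ?_⟩
      calc (v : A) * (s * a) = (a * v) * s := by ac_rfl
        _ = (b * v) * s := by rw [hv]
        _ = v * (s * b) := by ac_rfl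
    · rintro ⟨v, hv⟩
      refine ⟨v * s, ?_⟩
      rw [zero_mul', mem_madd_zero]
      push_cast
      calc a * (v * s : A) = v * (s * a) := by ac_rfl
        _ = v * (s * b) := hv
        _ = b * (v * s) := by ac_rfl
  madd_assoc := by
    intro x y z g e he hg
    obtain ⟨a, b, c, s, rfl, rfl, rfl⟩ := exists_common₃ x y z
    obtain ⟨g', e', t, rfl, rfl⟩ := exists_common₂ g e
    rw [mk_mul_den a s t, mk_mul_den b s t, mk_mul_den c s t] at *
    rw [mk_mul_den g' t s, mk_mul_den e' t s, mul_comm t s] at *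
    obtain ⟨v, hv⟩ := mk_mem_locAdd_common.1 hg
    obtain ⟨w, hw⟩ := mk_mem_locAdd_common.1 he
    have h1 := mul_mem_madd hw (v : A)
    have h2 := mul_mem_madd hv (w : A)
    rw [mul_right_comm (g' * s) (v : A) (w : A)] at h2
    obtain ⟨h, hh, hx⟩ := madd_assoc h1 h2
    refine ⟨Localization.mk h (s * t * (v * w)), ?_, ?_⟩
    · rw [mk_mul_den (b * t) (s * t) (v * w), mk_mul_den (c * t) (s * t) (v * w)]
      refine mk_mem_locAdd_common.2 ⟨1, ?_⟩
      push_cast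
      exact mem_congr hh (by ac_rfl) (by ac_rfl) (by ac_rfl)
    · rw [mk_mul_den (e' * s) (s * t) (v * w), mk_mul_den (a * t) (s * t) (v * w)]
      refine mk_mem_locAdd_common.2 ⟨1, ?_⟩
      push_cast
      exact mem_congr hx (by ac_rfl) (by ac_rfl) (by ac_rfl)
  madd_comm := by
    intro y z
    obtain ⟨b, c, s, rfl, rfl⟩ := exists_common₂ y z
    ext x
    obtain ⟨a, b', s', rfl, hb'⟩ := exists_common₂ x x
    rw [mk_mem_locAdd, mk_mem_locAdd]
    simp only [madd_comm (b * _)]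
  mul_zero' := by
    intro x
    induction x using Localization.induction_on with | H p => ?_
    rw [zero_eq_mk 1, Localization.mk_mul, mul_zero']
    exact (zero_eq_mk _).symm.trans (zero_eq_mk _)
  mul_mem_madd := by
    intro x y z h d
    obtain ⟨a, b, c, s, rfl, rfl, rfl⟩ := exists_common₃ x y z
    obtain ⟨v, hv⟩ := mk_mem_locAdd_common.1 h
    induction d using Localization.induction_on with | H p => ?_
    simp only [Localization.mk_mul]
    refine mk_mem_locAdd_common.2 ⟨v, ?_⟩
    exact mem_congr (mul_mem_madd hv p.1) (by ac_rfl) (by ac_rfl) (by ac_rfl)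

/-- For `T ≤ T'`, the canonical map `T⁻¹A → T'⁻¹A`, `a/s ↦ a/s`. -/
def locMap {T T' : Submonoid A} (h : T ≤ T') (x : Localization T) : Localization T' :=
  x.liftOn (fun a s => Localization.mk a ⟨s, h s.2⟩) (by
    intro a c b d hr
    rw [Localization.r_iff_exists] at hr
    obtain ⟨k, hk⟩ := hr
    rw [Localization.mk_eq_mk_iff, Localization.r_iff_exists]
    exact ⟨⟨k, h k.2⟩, hk⟩)

end Localization

section Sheaf

variable {A : Type u} [Multiring A]

/-- The value `S_a⁻¹A` of the structural presheaf on the basic open set `D(a)`. -/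
abbrev Sec (a : A) : Type u := Localization (S a)

/-- The restriction map of the structural presheaf for `D(b) ⊆ D(a)`. -/
def res {a b : A} (h : D b ⊆ D a) : Sec a → Sec b := locMap (S_le_of_D_subset h)

theorem D_subset_of_cover {ι : Type u} {e : A} {f : ι → A} (h : D e = ⋃ i, D (f i)) (i : ι) :
    D (f i) ⊆ D e := h ▸ Set.subset_iUnion (fun i => D (f i)) i

variable (A)

/-- The structural presheaf is a monopresheaf: the relation `a ∈ b + c` can be checked locally. -/
def IsMono : Prop :=
  ∀ (ι : Type u) (e : A) (f : ι → A) (hcov : D e = ⋃ i, D (f i)) (a b c : Sec e),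
    (∀ i, res (D_subset_of_cover hcov i) a ∈
      madd (res (D_subset_of_cover hcov i) b) (res (D_subset_of_cover hcov i) c)) →
    a ∈ madd b c

/-- The structural presheaf is a sheaf: it is a monopresheaf and compatible families glue. -/
structure IsGeometric : Prop where
  mono : IsMono A
  glue : ∀ (ι : Type u) (e : A) (f : ι → A) (hcov : D e = ⋃ i, D (f i)) (x : ∀ i, Sec (f i)),
    (∀ i j, res (D_mul_subset_left (f i) (f j)) (x i) =
      res (D_mul_subset_right (f i) (f j)) (x j)) →
    ∃ y : Sec e, ∀ i, res (D_subset_of_cover hcov i) y = x i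

end Sheaf

end Multiring

/-! Everything rests on splitting `A` along an idempotent. A complement of `a²` is some `g ∈ 1 - a²`
with `a g = 0`; then `g` is idempotent and `1 ∈ a² + g`. In a real reduced multiring `b a² + b g =
{b}` (`IsRealReduced.eq_of_mem_madd_compl`), so elements can be assembled from two components, and
the relation `a ∈ b + c` can be checked on the components (`IsRealReduced.mem_madd_of_compl`).
Complements therefore give the hyperring property; conversely, hyperdistributivity applied to `0 ∈ a
- a³` produces complements.

For the sheaf property, `D(e)` is quasi-compact, which in terms of complements says that `e` is
killed by a finite product of the `g i`. Since `a³ = a`, localizing at `S e` only means comparing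
elements after multiplication by `e`. Checking a relation on a cover and gluing a family then become
finite inductions, splitting along one `f j` at a time.

Conversely, for a geometric von Neumann hyperring, `1 + a² = {1}` propagates to `a + b² a = {a}`,
and regularity then forces `a³ = a`. The sheaf condition is needed only to show that `a² + b²` is a
singleton: its elements have prescribed products with `a²` and with a complement, and
`IsMono.eq_of_mul_eq` makes them equal. -/

namespace Multiring

/-! ### Arithmetic of multirings and of their localizations -/

section Arithmetic

variable {A : Type u} [Multiring A]

theorem zero_mem_madd_neg (a : A) : (0 : A) ∈ madd a (-a) := by
  rw [madd_comm]
  exact mem_madd_left (mem_madd_zero.2 rfl)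

theorem mem_zero_madd {a b : A} : a ∈ madd 0 b ↔ a = b := by
  rw [madd_comm, mem_madd_zero]

theorem neg_zero' : -(0 : A) = 0 := (mem_zero_madd.1 (zero_mem_madd_neg 0)).symm

theorem neg_neg' (a : A) : - -a = a := by
  have h : (0 : A) ∈ madd (-a) a := by
    rw [madd_comm]
    exact zero_mem_madd_neg a
  exact (mem_madd_zero.1 (mem_madd_left h)).symm

theorem mem_madd_of_mem_madd_neg {a b c : A} (h : a ∈ madd b (-c)) : b ∈ madd a c := by
  simpa [neg_neg'] using mem_madd_right h

/-- Allows two decomposed elements to be added component by component. -/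
theorem madd_madd_madd_comm {a b c d p q z : A} (hp : p ∈ madd a b) (hq : q ∈ madd c d)
    (hz : z ∈ madd p q) : ∃ r ∈ madd a c, ∃ s ∈ madd b d, z ∈ madd r s := by
  obtain ⟨h, hh, hzh⟩ := madd_assoc hz hp
  rw [madd_comm] at hh hzh
  obtain ⟨k, hk, hhk⟩ := madd_assoc hh hq
  rw [madd_comm] at hhk hk
  obtain ⟨m, hm, hzm⟩ := madd_assoc hzh hhk
  rw [madd_comm] at hm hzm
  exact ⟨m, hm, k, hk, hzm⟩

/-- In a hyperring the principal ideal of `x` is the set of multiples of `x`. -/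
theorem IsHyperring.exists_eq_mul_of_mem_genBy (hA : IsHyperring A) {x y : A}
    (h : y ∈ genBy x) : ∃ r, y = r * x := by
  refine h {y | ∃ r, y = r * x} ⟨⟨⟨0, (zero_mul' x).symm⟩, ?_, ?_⟩, 1, (one_mul x).symm⟩
  · rintro _ ⟨r, rfl⟩ _ ⟨s, rfl⟩ z hz
    obtain ⟨t, -, rfl⟩ := hA r s x z hz
    exact ⟨t, rfl⟩
  · rintro r _ ⟨s, rfl⟩
    exact ⟨r * s, (mul_assoc r s x).symm⟩

theorem self_mem_S (a : A) : a ∈ S a := ⟨1, by simpa using mem_genBy a⟩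

theorem res_mk {a b : A} (h : D b ⊆ D a) (x : A) (s : S a) :
    res h (Localization.mk x s) = Localization.mk x ⟨s, S_le_of_D_subset h s.2⟩ := rfl

theorem mk_eq_mk_common {T : Submonoid A} {a b : A} {s : T} :
    Localization.mk a s = Localization.mk b s ↔ ∃ v : T, a * v = b * v := by
  rw [Localization.mk_eq_mk_iff, Localization.r_iff_exists]
  constructor
  · rintro ⟨v, h⟩
    refine ⟨v * s, ?_⟩
    push_cast
    calc a * (v * s : A) = v * (s * a) := by ac_rfl
      _ = v * (s * b) := h
      _ = b * (v * s) := by ac_rfl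
  · rintro ⟨v, h⟩
    refine ⟨v, ?_⟩
    calc (v : A) * (s * a) = s * (a * v) := by ac_rfl
      _ = s * (b * v) := by rw [h]
      _ = v * (s * b) := by ac_rfl

end Arithmetic

/-! ### Complements, gluing and the structure sheaf of a real reduced multiring -/

section RealReduced

variable {A : Type u} [Multiring A]

/-- `g` is a complement of the idempotent `a²`. -/
def IsSqCompl (a g : A) : Prop := a * g = 0 ∧ g ∈ madd (1 : A) (-(a ^ 2))

theorem IsSqCompl.one_mem {a g : A} (h : IsSqCompl a g) : (1 : A) ∈ madd (a ^ 2) g := by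
  rw [madd_comm]
  exact mem_madd_of_mem_madd_neg h.2

theorem IsSqCompl.sq_eq {a g : A} (h : IsSqCompl a g) : g ^ 2 = g := by
  have h1 := mul_mem_madd h.2 g
  rw [neg_mul', pow_two a, mul_assoc, h.1, mul_zero', neg_zero', mem_madd_zero, one_mul] at h1
  rw [pow_two, h1]

theorem IsRealReduced.pow_two_mul_add_one (hA : IsRealReduced A) (a : A) (n : ℕ) :
    a ^ (2 * n + 1) = a := by
  induction n with
  | zero => simp
  | succ n ih =>
    calc a ^ (2 * (n + 1) + 1) = a ^ (2 * n + 1) * a ^ 2 := by rw [← pow_add]; congr 1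
      _ = a ^ 3 := by rw [ih, ← pow_succ']
      _ = a := hA.cube a

theorem IsRealReduced.mul_eq_zero_of_pow (hA : IsRealReduced A) {a b : A} {n : ℕ}
    (h : a ^ n * b = 0) : a * b = 0 := by
  calc a * b = a ^ (2 * n + 1) * b := by rw [hA.pow_two_mul_add_one]
    _ = a ^ (n + 1) * (a ^ n * b) := by rw [← mul_assoc, ← pow_add]; congr 2; omega
    _ = 0 := by rw [h, mul_zero']

/-- The sum of the two components of `b` along an idempotent and its complement is `{b}`. -/
theorem IsRealReduced.eq_of_mem_madd_compl (hA : IsRealReduced A) {a g b x : A}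
    (h : IsSqCompl a g) (hx : x ∈ madd (b * a ^ 2) (b * g)) : x = b := by
  have hb : b ∈ madd (b * a ^ 2) (b * g) :=
    mem_congr (mul_mem_madd h.one_mem b) (one_mul b).symm (mul_comm _ _) (mul_comm _ _)
  have ha4 : a ^ 2 * a ^ 2 = a ^ 2 := by rw [← pow_add, pow_succ, hA.cube, ← pow_two]
  have hg := h.sq_eq
  have hag : a ^ 2 * g = 0 := by rw [pow_two, mul_assoc, h.1, mul_zero']
  have hga : g * a ^ 2 = 0 := by rw [mul_comm, hag]
  have comp : ∀ y ∈ madd (b * a ^ 2) (b * g), y * a ^ 2 = b * a ^ 2 ∧ y * g = b * g := by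
    intro y hy
    constructor
    · have := mul_mem_madd hy (a ^ 2)
      rwa [mul_assoc b g, hga, mul_zero', mem_madd_zero, mul_assoc b, ha4] at this
    · have := mul_mem_madd hy g
      rwa [mul_assoc b (a ^ 2), hag, mul_zero', mem_zero_madd, mul_assoc b, ← pow_two, hg] at this
  -- If `y` and `w` both have the components of `b`, then `y w` lies in `(b a)² + (b g)² = {c}`.
  -- Hence `x b = b² = x² = c`, and cubing gives `x = x³ = b³ = b`.
  obtain ⟨c, hc⟩ := hA.sq_add_sq (b * a) (b * g)
  have single : ∀ y ∈ madd (b * a ^ 2) (b * g), ∀ w, w * a ^ 2 = b * a ^ 2 → w * g = b * g →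
      y * w = c := by
    intro y hy w hw1 hw2
    have h1 := mul_mem_madd hy w
    have : y * w ∈ madd ((b * a) ^ 2) ((b * g) ^ 2) := by
      refine mem_congr h1 rfl ?_ ?_
      · rw [mul_assoc, mul_comm _ w, hw1, mul_pow, pow_two b, mul_assoc]
      · rw [mul_assoc, mul_comm _ w, hw2, mul_pow, hg, pow_two b, mul_assoc]
    rwa [hc] at this
  have hxb := single x hx b rfl rfl
  have hbb := single b hb b rfl rfl
  have hxx := single x hx x (comp x hx).1 (comp x hx).2
  calc x = x ^ 3 := (hA.cube x).symm
    _ = x * x * x := by rw [pow_succ, pow_two]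
    _ = x * b * b := by rw [hxx, ← hbb, mul_comm, ← mul_assoc]
    _ = b * b * b := by rw [hxb, ← hbb]
    _ = b ^ 3 := by rw [pow_succ, pow_two]
    _ = b := hA.cube b

/-- The relation `a ∈ b + c` can be checked on an idempotent and on its complement. -/
theorem IsRealReduced.mem_madd_of_compl (hA : IsRealReduced A) {f g a b c : A}
    (h : IsSqCompl f g) (h1 : a * f ∈ madd (b * f) (c * f)) (h2 : a * g ∈ madd (b * g) (c * g)) :
    a ∈ madd b c := by
  have h1' : a * f ^ 2 ∈ madd (b * f ^ 2) (c * f ^ 2) := by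
    simpa only [mul_assoc, ← pow_two] using mul_mem_madd h1 f
  have ha : a ∈ madd (a * f ^ 2) (a * g) :=
    mem_congr (mul_mem_madd h.one_mem a) (one_mul a).symm (mul_comm _ _) (mul_comm _ _)
  obtain ⟨r, hr, s, hs, hz⟩ := madd_madd_madd_comm h1' h2 ha
  rwa [hA.eq_of_mem_madd_compl h hr, hA.eq_of_mem_madd_compl h hs] at hz

/-- Given `x ∈ b d + c d`, the required `a` is assembled so that `a d = x` and, on the complement
`g` of `d²`, `a` agrees with an arbitrary `y ∈ b + c`. The relation `a ∈ b + c` then holds on both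
components. -/
theorem IsRealReduced.isHyperring (hA : IsRealReduced A) (h : ∀ a : A, ∃ g, IsSqCompl a g) :
    IsHyperring A := by
  intro b c d x hx
  obtain ⟨g, hg⟩ := h d
  obtain ⟨y, hy⟩ := madd_nonempty b c
  obtain ⟨a, ha⟩ := madd_nonempty (x * d) (y * g)
  have hgd : g * d = 0 := by rw [mul_comm, hg.1]
  have hxg : x * g = 0 := by
    have := mul_mem_madd hx g
    rwa [mul_assoc b, mul_assoc c, hg.1, mul_zero', mul_zero', mem_zero_madd] at this
  have hxd : x = x * d ^ 2 := by
    have := mul_mem_madd hg.one_mem x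
    rw [one_mul, mul_comm g, hxg, mem_madd_zero] at this
    rwa [mul_comm]
  have had : a * d = x := by
    have := mul_mem_madd ha d
    rwa [mul_assoc y, hgd, mul_zero', mem_madd_zero, mul_assoc, ← pow_two, ← hxd] at this
  have hag : a * g = y * g := by
    have := mul_mem_madd ha g
    rwa [mul_assoc x, hg.1, mul_zero', mem_zero_madd, mul_assoc, ← pow_two, hg.sq_eq] at this
  refine ⟨a, hA.mem_madd_of_compl hg ?_ ?_, had.symm⟩
  · rwa [had]
  · rw [hag]
    exact mul_mem_madd hy g

/-- Since `a³ = a`, zero lies in `1·a + (-a²)·a`; the converse of half distributivity writes it as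
`g a` with `g ∈ 1 - a²`. -/
theorem IsRealReduced.exists_isCompl (hA : IsRealReduced A) (h : IsHyperring A) (a : A) :
    ∃ g, IsSqCompl a g := by
  obtain ⟨g, hg, h0⟩ := h 1 (-(a ^ 2)) a 0 (by
    rw [one_mul, neg_mul', ← pow_succ, hA.cube]
    exact zero_mem_madd_neg a)
  exact ⟨g, by rw [mul_comm, ← h0], hg⟩

/-- The relation `a ∈ b + c` holds on `u` if it holds on all members of a finite cover of `u`. -/
theorem IsRealReduced.mem_madd_of_finset (hA : IsRealReduced A) {ι : Type*} {f g : ι → A}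
    (hfg : ∀ i, IsSqCompl (f i) (g i)) {a b c : A} (t : Finset ι) :
    ∀ u : A, (∀ i ∈ t, a * (u * f i) ∈ madd (b * (u * f i)) (c * (u * f i))) →
      u * ∏ i ∈ t, g i = 0 → a * u ∈ madd (b * u) (c * u) := by
  classical
  induction t using Finset.induction_on with
  | empty =>
    intro u _ hu
    rw [Finset.prod_empty, mul_one] at hu
    rw [hu, mul_zero', mul_zero', mul_zero', mem_madd_zero]
  | insert j t hj ih =>
    intro u hf hu
    rw [Finset.prod_insert hj, ← mul_assoc] at hu
    refine hA.mem_madd_of_compl (hfg j) ?_ ?_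
    · simpa only [mul_assoc] using hf j (Finset.mem_insert_self j t)
    · have := ih (u * g j) (fun i hi => ?_) hu
      · simpa only [mul_assoc] using this
      · exact mem_congr (mul_mem_madd (hf i (Finset.mem_insert_of_mem hi)) (g j))
          (by ac_rfl) (by ac_rfl) (by ac_rfl)

/-- A family that is compatible on pairwise products glues over a finite index set. -/
theorem IsRealReduced.exists_glue_finset (hA : IsRealReduced A) {ι : Type*} {f g : ι → A}
    (hfg : ∀ i, IsSqCompl (f i) (g i)) {y : ι → A}
    (hy : ∀ i j, y i * (f i * f j) = y j * (f i * f j)) (t : Finset ι) :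
    ∃ z, ∀ i ∈ t, z * f i = y i * f i := by
  classical
  induction t using Finset.induction_on with
  | empty => exact ⟨0, by simp⟩
  | insert j t hj ih =>
    obtain ⟨z, hz⟩ := ih
    -- The new element is `y j` on `D(f j)` and keeps the old value `z` on the complement.
    obtain ⟨w, hw⟩ := madd_nonempty (y j * f j ^ 2) (z * g j)
    refine ⟨w, fun i hi => ?_⟩
    rcases Finset.mem_insert.1 hi with rfl | hi
    · have := mul_mem_madd hw (f i)
      rwa [mul_assoc z, mul_comm (g i), (hfg i).1, mul_zero', mem_madd_zero, mul_assoc, ← pow_succ,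
        hA.cube] at this
    · refine hA.eq_of_mem_madd_compl (hfg j) (mem_congr (mul_mem_madd hw (f i)) rfl ?_ ?_)
      · calc y i * f i * f j ^ 2 = y i * (f i * f j) * f j := by rw [pow_two]; ac_rfl
          _ = y j * (f i * f j) * f j := by rw [hy]
          _ = y j * f j ^ 2 * f i := by rw [pow_two]; ac_rfl
      · rw [← hz i hi, mul_right_comm]

/-- Quasi-compactness of `D e`, in terms of the complements of the members of a cover. -/
theorem IsRealReduced.exists_finset_of_cover (hA : IsRealReduced A) {ι : Type*} {e : A}
    {f g : ι → A} (hfg : ∀ i, IsSqCompl (f i) (g i)) (hcov : D e ⊆ ⋃ i, D (f i)) :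
    ∃ t : Finset ι, e * ∏ i ∈ t, g i = 0 := by
  classical
  have mono : ∀ {x : A} {t t' : Finset ι}, t ⊆ t' → x * ∏ i ∈ t, g i = 0 →
      x * ∏ i ∈ t', g i = 0 := by
    intro x t t' htt hx
    rw [← Finset.prod_sdiff htt, mul_left_comm, hx, mul_zero']
  have hI : IsIdeal {x : A | ∃ t : Finset ι, x * ∏ i ∈ t, g i = 0} := by
    refine ⟨⟨∅, zero_mul' _⟩, ?_, ?_⟩
    · rintro x ⟨t, hx⟩ y ⟨t', hy⟩ z hz
      refine ⟨t ∪ t', ?_⟩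
      have := mul_mem_madd hz (∏ i ∈ t ∪ t', g i)
      rwa [mono Finset.subset_union_left hx, mono Finset.subset_union_right hy,
        mem_madd_zero] at this
    · rintro r x ⟨t, hx⟩
      exact ⟨t, by rw [mul_assoc, hx, mul_zero']⟩
  by_contra! hcon
  -- A prime containing this ideal but not `e` lies in some `D(f i)`, although `f i * g i = 0` puts
  -- `f i` in the ideal.
  obtain ⟨p, hp, hIp, hep⟩ := exists_prime hI e fun n ⟨t, ht⟩ =>
    hcon t (hA.mul_eq_zero_of_pow ht)
  obtain ⟨i, hi⟩ := Set.mem_iUnion.1 (hcov (a := (⟨p, hp⟩ : Spec A)) hep)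
  exact hi (hIp ⟨{i}, by simpa using (hfg i).1⟩)

/-- If `aⁿ = r s`, then `a = a^(2n+1)` is also a multiple of `s`. Thus every denominator in `S a`
may be replaced by `a` itself. -/
theorem IsRealReduced.exists_eq_mul_of_mem_S (hA : IsRealReduced A) (h : IsHyperring A)
    {a s : A} (hs : s ∈ S a) : ∃ r, a = r * s := by
  obtain ⟨n, hn⟩ := hs
  obtain ⟨r, hr⟩ := h.exists_eq_mul_of_mem_genBy hn
  refine ⟨a ^ (n + 1) * r, ?_⟩
  rw [mul_assoc, ← hr, ← pow_add, show n + 1 + n = 2 * n + 1 by omega, hA.pow_two_mul_add_one]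

theorem IsRealReduced.mk_mem_madd_iff (hA : IsRealReduced A) (h : IsHyperring A) {e a b c : A}
    {s : S e} : (Localization.mk a s : Sec e) ∈ madd (Localization.mk b s : Sec e)
      (Localization.mk c s) ↔ a * e ∈ madd (b * e) (c * e) := by
  refine mk_mem_locAdd_common.trans ⟨?_, fun hv => ⟨⟨e, self_mem_S e⟩, hv⟩⟩
  rintro ⟨v, hv⟩
  obtain ⟨r, hr⟩ := hA.exists_eq_mul_of_mem_S h v.2
  rw [hr]
  exact mem_congr (mul_mem_madd hv r) (by ac_rfl) (by ac_rfl) (by ac_rfl)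

theorem IsRealReduced.mk_eq_mk_iff (hA : IsRealReduced A) (h : IsHyperring A) {e a b : A}
    {s : S e} : (Localization.mk a s : Sec e) = Localization.mk b s ↔ a * e = b * e := by
  refine mk_eq_mk_common.trans ⟨?_, fun hv => ⟨⟨e, self_mem_S e⟩, hv⟩⟩
  rintro ⟨v, hv⟩
  obtain ⟨r, hr⟩ := hA.exists_eq_mul_of_mem_S h v.2
  calc a * e = a * (r * v) := congrArg (a * ·) hr
    _ = a * v * r := by ac_rfl
    _ = b * v * r := by rw [hv]
    _ = b * (r * v) := by ac_rfl
    _ = b * e := congrArg (b * ·) hr.symm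

/-- Every section over `D(e)` comes from an element of `A`. -/
theorem IsRealReduced.exists_mk_one (hA : IsRealReduced A) (h : IsHyperring A) {e : A}
    (x : Sec e) : ∃ y : A, x = Localization.mk y 1 := by
  induction x using Localization.induction_on with | H p => ?_
  obtain ⟨a, s⟩ := p
  obtain ⟨r, hr⟩ := hA.exists_eq_mul_of_mem_S h s.2
  -- From `e = r s` one gets `a/s = a r/e`, and `1/e = e` over `D(e)` because `e³ = e`.
  refine ⟨a * r * e, ?_⟩
  rw [mk_mul_den (a * r * e) 1 s, one_mul, hA.mk_eq_mk_iff h]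
  calc a * e = a * e ^ 3 := by rw [hA.cube]
    _ = a * (r * s) * e * e := by rw [← hr, pow_succ, pow_two]; ac_rfl
    _ = a * r * e * s * e := by ac_rfl

theorem IsRealReduced.isGeometric (hA : IsRealReduced A) (h : IsHyperring A) :
    IsGeometric A where
  mono := by
    intro ι e f hcov a b c habc
    choose g hg using fun i => hA.exists_isCompl h (f i)
    obtain ⟨a, b, c, s, rfl, rfl, rfl⟩ := exists_common₃ a b c
    obtain ⟨t, ht⟩ := hA.exists_finset_of_cover hg hcov.subset
    rw [hA.mk_mem_madd_iff h]
    refine hA.mem_madd_of_finset hg t e (fun i _ => ?_) ht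
    have := habc i
    simp only [res_mk] at this
    rw [hA.mk_mem_madd_iff h] at this
    exact mem_congr (mul_mem_madd this e) (by ac_rfl) (by ac_rfl) (by ac_rfl)
  glue := by
    intro ι e f hcov x hx
    choose g hg using fun i => hA.exists_isCompl h (f i)
    choose y hy using fun i => hA.exists_mk_one h (x i)
    obtain ⟨t, ht⟩ := hA.exists_finset_of_cover hg hcov.subset
    have hcomp : ∀ i j, y i * (f i * f j) = y j * (f i * f j) := by
      intro i j
      have := hx i j
      rw [hy i, hy j, res_mk, res_mk] at this
      exact (hA.mk_eq_mk_iff h).1 this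
    obtain ⟨z, hz⟩ := hA.exists_glue_finset hg hcomp t
    refine ⟨Localization.mk z 1, fun k => ?_⟩
    rw [hy k, res_mk]
    refine (hA.mk_eq_mk_iff h (s := 1)).2 ?_
    -- The index `k` need not belong to `t`. But `f k` is a multiple of `e`, so the finite subcover
    -- of `D(e)` also covers `D(f k)`, and `z` can be compared with `y k` there; equality is
    -- expressed as membership in a sum with `0`.
    obtain ⟨r, hr⟩ := hA.exists_eq_mul_of_mem_S h
      (S_le_of_D_subset (D_subset_of_cover hcov k) (self_mem_S e))
    rw [← mem_madd_zero, ← zero_mul' (f k)]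
    refine hA.mem_madd_of_finset hg t (f k) (fun i hi => ?_) ?_
    · rw [zero_mul', mem_madd_zero, hcomp k i, mul_comm (f k), ← mul_assoc, hz i hi, mul_assoc]
    · rw [hr, mul_assoc, ht, mul_zero']

end RealReduced

/-! ### From geometric von Neumann hyperrings to real reduced hyperrings -/

section VonNeumann

variable {A : Type u} [Multiring A]

theorem madd_sq_mul (h : IsHyperring A) (h1 : ∀ a : A, madd (1 : A) (a ^ 2) = {1}) (a b : A) :
    madd a (b ^ 2 * a) = {a} := by
  have key : ∀ x ∈ madd a (b ^ 2 * a), x = a := by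
    intro x hx
    obtain ⟨c, hc, rfl⟩ := h 1 (b ^ 2) a x (by rwa [one_mul])
    rw [h1] at hc
    rw [Set.mem_singleton_iff.1 hc, one_mul]
  obtain ⟨x, hx⟩ := madd_nonempty a (b ^ 2 * a)
  exact Set.Subset.antisymm key (Set.singleton_subset_iff.2 (key x hx ▸ hx))

theorem IsVonNeumannHyperring.cube (h : IsVonNeumannHyperring A)
    (h1 : ∀ a : A, madd (1 : A) (a ^ 2) = {1}) (a : A) : a ^ 3 = a := by
  obtain ⟨b, hb⟩ := h.regular a
  have e1 : b ^ 2 * a ^ 2 = a * b := by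
    calc b ^ 2 * a ^ 2 = a ^ 2 * b * b := by rw [pow_two b]; ac_rfl
      _ = a * b := by rw [← hb]
  have e2 : a ^ 2 * (a * b) = a ^ 2 := by
    calc a ^ 2 * (a * b) = a * (a ^ 2 * b) := by ac_rfl
      _ = a ^ 2 := by rw [← hb, pow_two]
  -- Each of `a²` and `a b` is a square multiple of the other, so `a² + a b` equals both `{a²}` and
  -- `{a b}`; hence `a² = a b`.
  have s1 := madd_sq_mul h.hyper h1 (a ^ 2) b
  have s2 := madd_sq_mul h.hyper h1 (a * b) a
  rw [e1] at s1
  rw [e2, madd_comm, s1] at s2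
  calc a ^ 3 = a ^ 2 * a := pow_succ a 2
    _ = a * b * a := by rw [Set.singleton_injective s2]
    _ = a ^ 2 * b := by rw [mul_right_comm, ← pow_two]
    _ = a := hb.symm

/-- In a geometric hyperring elements that agree on `u` and on `v` are equal if `1 ∈ u + v`. -/
theorem IsMono.eq_of_mul_eq (hm : IsMono A) (h : IsHyperring A) {u v x y : A}
    (huv : (1 : A) ∈ madd u v) (hu : x * u = y * u) (hv : x * v = y * v) : x = y := by
  have hcov : D (1 : A) = ⋃ i : ULift.{u} Bool, D (if i.down then u else v) := by
    ext p
    refine ⟨fun _ => ?_, fun _ => p.2.one_notMem⟩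
    rw [Set.mem_iUnion]
    by_contra! hcon
    have hpu : u ∈ p.1 := not_not.1 (hcon ⟨true⟩)
    have hpv : v ∈ p.1 := not_not.1 (hcon ⟨false⟩)
    exact p.2.one_notMem (p.2.add_subset hpu hpv huv)
  have key := hm _ 1 _ hcov (Localization.mk x 1) (Localization.mk y 1) 0 (by
    intro i
    rw [zero_eq_mk 1, res_mk, res_mk, res_mk]
    refine mk_mem_locAdd_common.2 ⟨⟨_, self_mem_S _⟩, ?_⟩
    rw [zero_mul', mem_madd_zero]
    obtain ⟨_ | _⟩ := i
    · simpa using hv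
    · simpa using hu)
  rw [mem_madd_zero, mk_eq_mk_common] at key
  -- Elements of `S 1` are invertible, so the equality over `D(1)` descends to `A`.
  obtain ⟨⟨s, n, hs⟩, hxy⟩ := key
  obtain ⟨r, hr⟩ := h.exists_eq_mul_of_mem_genBy hs
  rw [one_pow] at hr
  calc x = x * s * r := by rw [mul_assoc, mul_comm s, ← hr, mul_one]
    _ = y * s * r := by rw [hxy]
    _ = y := by rw [mul_assoc, mul_comm s, ← hr, mul_one]

theorem isSemiReal_of_one_madd_sq (hA : (1 : A) ≠ 0)
    (h1 : ∀ a : A, madd (1 : A) (a ^ 2) = {1}) : IsSemiReal A := by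
  -- Adding squares to `1` one at a time never leaves `{1}`. If `-1` were a sum of squares, `0 ∈ 1 +
  -- (-1)` would give `0 = 1`.
  have key : ∀ l : List A, ∀ z ∈ msum (l.map fun a => a ^ 2), ∀ x ∈ madd 1 z, x = 1 := by
    intro l
    induction l with
    | nil =>
      intro z hz x hx
      rw [Set.mem_singleton_iff.1 hz, mem_madd_zero] at hx
      exact hx
    | cons a l ih =>
      rintro z ⟨w, hw, hz⟩ x hx
      rw [madd_comm] at hx hz
      obtain ⟨k, hk, hxk⟩ := madd_assoc hx hz
      rw [madd_comm, h1] at hk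
      rw [Set.mem_singleton_iff.1 hk, madd_comm] at hxk
      exact ih w hw x hxk
  rintro ⟨l, hl⟩
  exact hA (key l _ hl 0 (zero_mem_madd_neg 1)).symm

theorem IsVonNeumannHyperring.isRealReduced (h : IsVonNeumannHyperring A) (hm : IsMono A)
    (hA : (1 : A) ≠ 0) (h1 : ∀ a : A, madd (1 : A) (a ^ 2) = {1}) : IsRealReduced A where
  semiReal := isSemiReal_of_one_madd_sq hA h1
  cube := h.cube h1
  add_sq_mul := madd_sq_mul h.hyper h1
  sq_add_sq := by
    intro a b
    have ha4 : a ^ 2 * a ^ 2 = a ^ 2 := by rw [← pow_add, pow_succ, h.cube h1, ← pow_two]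
    obtain ⟨g, hg, h0⟩ := h.hyper 1 (-(a ^ 2)) (a ^ 2) 0 (by
      rw [one_mul, neg_mul', ha4]
      exact zero_mem_madd_neg _)
    have h1g : (1 : A) ∈ madd (a ^ 2) g := by
      rw [madd_comm]
      exact mem_madd_of_mem_madd_neg hg
    -- On `a²` the sum is absorbed, `a² + b² a² = {a²}`; on `g` the first summand vanishes. Both
    -- components of `x` are thus independent of the choice of `x`.
    have key : ∀ x ∈ madd (a ^ 2) (b ^ 2), x * a ^ 2 = a ^ 2 ∧ x * g = b ^ 2 * g := by
      intro x hx
      constructor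
      · have := mul_mem_madd hx (a ^ 2)
        rwa [ha4, madd_sq_mul h.hyper h1] at this
      · have := mul_mem_madd hx g
        rwa [mul_comm (a ^ 2), ← h0, mem_zero_madd] at this
    obtain ⟨c, hc⟩ := madd_nonempty (a ^ 2) (b ^ 2)
    refine ⟨c, Set.Subset.antisymm (fun x hx => ?_) (Set.singleton_subset_iff.2 hc)⟩
    exact hm.eq_of_mul_eq h.hyper h1g ((key x hx).1.trans (key c hc).1.symm)
      ((key x hx).2.trans (key c hc).2.symm)

end VonNeumann

end Multiring

theorem mainTheorem9 (A : Type u) [Multiring A] (hA : (1 : A) ≠ 0) :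
    List.TFAE [
      Multiring.IsRealReduced A ∧
        ∀ a : A, ∃ x : A, a * x = 0 ∧ x ∈ Multiring.madd (1 : A) (-(a ^ 2)),
      Multiring.IsRealReduced A ∧ Multiring.IsHyperring A,
      Multiring.IsVonNeumannHyperring A ∧ Multiring.IsGeometric A ∧
        ∀ a : A, Multiring.madd (1 : A) (a ^ 2) = {1}] := by
  tfae_have 1 → 2 := fun ⟨h, hc⟩ => ⟨h, h.isHyperring hc⟩
  tfae_have 2 → 1 := fun ⟨h, hh⟩ => ⟨h, h.exists_isCompl hh⟩
  tfae_have 2 → 3 := fun ⟨h, hh⟩ =>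
    ⟨⟨hh, fun a => ⟨a, by rw [← pow_succ, h.cube]⟩⟩, h.isGeometric hh,
      fun a => by simpa using h.add_sq_mul 1 a⟩
  tfae_have 3 → 2 := fun ⟨hv, hg, h1⟩ => ⟨hv.isRealReduced hg.mono hA h1, hv.hyper⟩
  tfae_finish
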